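/- Let $R$ be a commutative ring with unit and let $r\ge 0$ be an integer. **Filtered complexes.** A filtered complex $(A,d,F)$ is an unbounded cochain complex $(A,d)$ of $R$-modules with submodules $F_pA^n\subseteq A^n$ ($p,n\in\mathbb Z$) such that $F_{p-1}A^n\subseteq F_pA^n$ and $d(F_pA^n)\subseteq F_pA^{n+1}$. Morphisms are morphisms of complexes with $f(F_pA)\subseteq F_pB$. An $r$-homotopy from $f$ to $g$, for morphisms $f,g:A\to B$, is a map $h:A\to B$ of graded $R$-modules of degree $-1$ such that $dh+hd=g-f$ and $h(F_pA)\subseteq F_{p+r}B$ for all $p$. **Spectral sequences.** A spectral sequence $(A,\psi)$ consists of, for each $m\ge 0$, a bigraded $R$-module $A_m=\{A_m^{p,q}\}_{p,q\in\mathbb Z}$ with a differential $d_m:A_m^{p,q}\to A_m^{p-m,q+1-m}$, $d_m^2=0$, and isomorphisms of bigraded modules $\psi_m:H_*(A_m)\to A_{m+1}$. Morphisms are families $f_m:A_m\to B_m$ ($m\ge0$) of bidegree $(0,0)$ commuting with the differentials and with the maps $\psi_m$. **The spectral sequence functor $E$.** For a filtered complex $A$ and $m\ge0$ put $Z_m^{p,n+p}=F_pA^n\cap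 d^{-1}(F_{p-m}A^{n+1})$, $B_0^{p,n+p}=Z_0^{p-1,n+p-1}$, $B_m^{p,n+p}=Z_{m-1}^{p-1,n+p-1}+dZ_{m-1}^{p+m-1,n+p+m-2}$ for $m\ge1$. The spectral sequence $E(A)$ has pages $E_m^{p,q}(A)=Z_m^{p,q}/B_m^{p,q}$ and differentials $\delta_m[a]_m=[da]_m$, with $\psi_m$ sending the homology class of $[a]_m$ to $[a]_{m+1}$ for $a\in Z_{m+1}$; a morphism $f$ induces $[a]_m\mapsto[f(a)]_m$. **The $r$-path and $r$-homotopies of spectral sequences.** Let $\Lambda_r=Re_-\oplus Re_+\oplus Ru$, with $e_\pm$ in bidegree $(0,0)$, $u$ in bidegree $(-r,1-r)$, and all differentials zero except $d_r(e_-)=-u$, $d_r(e_+)=u$. For a spectral sequence $A$ let $P(r;A)=\Lambda_r\otimes A$, where an element of bidegree $(p,q)$ has total degree $q-p$ and $d(a\otimes b)=da\otimes b+(-1)^{|a|}a\otimes db$. Explicitly, for $0\le m\le r$, $$P_m(r;A)^{p,q}=A_m^{p,q}\oplus A_m^{p+r,q+r-1}\oplus A_m^{p,q},$$ with differential $D_m(x,y,z)=(d_mx,\,-d_my,\,d_mz)$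 for $m<r$ and $D_r(x,y,z)=(d_rx,\,-x-d_ry+z,\,d_rz)$; for $m>r$, $P_m(r;A)=A_m$ and $D_m=d_m$. Its characteristic maps are induced by those of $A$: they send the class of $(x,y,z)$ to $([x],[y],[z])$ for $m<r$, to $[x]=[z]$ for $m=r$, and are those of $A$ for $m>r$. There are morphisms $\partial^-_A,\partial^+_A:P(r;A)\to A$ given by $\partial^-_A(x,y,z)=x$ and $\partial^+_A(x,y,z)=z$ on the $m$-page for $m\le r$ and by the identity for $m>r$. An $r$-homotopy from $f$ to $g$, for morphisms $f,g:A\to B$ of spectral sequences, is a morphism $h:A\to P(r;B)$ such that $\partial^-_B\circ h=f$ and $\partial^+_B\circ h=g$. **Proposition.** The functor $E$ from filtered complexes to spectral sequences preserves $r$-homotopy: if $f,g:A\to B$ are morphisms of filtered complexes and there is an $r$-homotopy from $f$ to $g$, then there is an $r$-homotopy of spectral sequences from $E(f)$ to $E(g)$. -/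

import Mathlib

open CategoryTheory

universe v u


namespace HomologyClass

variable {R : Type u} [CommRing R] {ι : Type*} {c : ComplexShape ι}
  (K L : HomologicalComplex (ModuleCat.{v} R) c)

/-- The map sending a cycle (an element of the kernel of the outgoing differential)
to its class in homology. -/
noncomputable def mk (j k : ι) (hk : c.next j = k) :
    LinearMap.ker (K.d j k).hom →ₗ[R] K.homology j :=
  (K.liftCycles (A := ModuleCat.of R (LinearMap.ker (K.d j k).hom))
    (ModuleCat.ofHom (LinearMap.ker (K.d j k).hom).subtype) k hk (by ext x; exact x.2) ≫ K.homologyπ j).hom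
end HomologyClass
namespace HomologyClass
variable {R : Type u} [CommRing R] {ι : Type*} {c : ComplexShape ι}
  {K L : HomologicalComplex (ModuleCat.{v} R) c}

lemma iCycles_lift {j k : ι} (hk : c.next j = k) (z : LinearMap.ker (K.d j k).hom) :
    (K.iCycles j).hom ((K.liftCycles (A := ModuleCat.of R (LinearMap.ker (K.d j k).hom))
      (ModuleCat.ofHom (LinearMap.ker (K.d j k).hom).subtype) k hk (by ext x; exact x.2)).hom z)
      = z.1 := by
  rw [← LinearMap.comp_apply, ← ModuleCat.hom_comp, HomologicalComplex.liftCycles_i]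
  rfl

lemma mk_surjective {j k : ι} (hk : c.next j = k) : Function.Surjective (mk K j k hk) := by
  intro y
  obtain ⟨w, rfl⟩ := (ModuleCat.epi_iff_surjective (K.homologyπ j)).1 inferInstance y
  refine ⟨⟨(K.iCycles j).hom w, ?_⟩, ?_⟩
  · rw [LinearMap.mem_ker, ← LinearMap.comp_apply, ← ModuleCat.hom_comp, K.iCycles_d]; rfl
  · refine congrArg (K.homologyπ j).hom ?_
    apply (ModuleCat.mono_iff_injective (K.iCycles j)).1 inferInstance
    exact iCycles_lift hk _

lemma mk_eq_zero_iff {i j k : ι} (hi : c.prev j = i) (hk : c.next j = k)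
    (z : LinearMap.ker (K.d j k).hom) :
    mk K j k hk z = 0 ↔ ∃ w : K.X i, (K.d i j).hom w = z.1 := by
  have hex : (ShortComplex.mk (K.toCycles i j) (K.homologyπ j)
      (K.toCycles_comp_homologyπ i j)).Exact :=
    ShortComplex.exact_of_g_is_cokernel _ (K.homologyIsCokernel i j hi)
  rw [ShortComplex.moduleCat_exact_iff] at hex
  have key : ∀ w, (K.iCycles j).hom ((K.toCycles i j).hom w) = (K.d i j).hom w := by
    intro w
    rw [← LinearMap.comp_apply, ← ModuleCat.hom_comp, K.toCycles_i]
  constructor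
  · intro h
    obtain ⟨w, hw⟩ := hex _ h
    refine ⟨w, ?_⟩
    rw [← key]
    exact (congrArg (K.iCycles j).hom hw).trans (iCycles_lift hk z)
  · rintro ⟨w, hw⟩
    have : (K.toCycles i j).hom w = (K.liftCycles (A := ModuleCat.of R (LinearMap.ker (K.d j k).hom))
      (ModuleCat.ofHom (LinearMap.ker (K.d j k).hom).subtype) k hk (by ext x; exact x.2)).hom z := by
      apply (ModuleCat.mono_iff_injective (K.iCycles j)).1 inferInstance
      exact (key w).trans (hw.trans (iCycles_lift hk z).symm)
    refine (congrArg (K.homologyπ j).hom this.symm).trans ?_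
    rw [← LinearMap.comp_apply, ← ModuleCat.hom_comp, K.toCycles_comp_homologyπ]; rfl

lemma map_mk (f : K ⟶ L) {j k : ι} (hk : c.next j = k) (z : LinearMap.ker (K.d j k).hom)
    (z' : LinearMap.ker (L.d j k).hom) (h : z'.1 = (f.f j).hom z.1) :
    (HomologicalComplex.homologyMap f j).hom (mk K j k hk z) = mk L j k hk z' := by
  have h1 : ∀ w, (HomologicalComplex.homologyMap f j).hom ((K.homologyπ j).hom w) =
      (L.homologyπ j).hom ((HomologicalComplex.cyclesMap f j).hom w) := by
    intro w
    rw [← LinearMap.comp_apply, ← ModuleCat.hom_comp, HomologicalComplex.homologyπ_naturality]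
    rfl
  have h2 : ∀ w, (L.iCycles j).hom ((HomologicalComplex.cyclesMap f j).hom w) =
      (f.f j).hom ((K.iCycles j).hom w) := by
    intro w
    rw [← LinearMap.comp_apply, ← ModuleCat.hom_comp, HomologicalComplex.cyclesMap_i]
    rfl
  refine (h1 _).trans (congrArg (L.homologyπ j).hom ?_)
  apply (ModuleCat.mono_iff_injective (L.iCycles j)).1 inferInstance
  refine (h2 _).trans (Eq.trans ?_ (iCycles_lift hk z').symm)
  exact (congrArg (f.f j).hom (iCycles_lift hk z)).trans h.symm

lemma hom_ext {j k : ι} (hk : c.next j = k) {M : ModuleCat.{v} R} {f g : K.homology j ⟶ M}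
    (h : ∀ z, f.hom (mk K j k hk z) = g.hom (mk K j k hk z)) : f = g := by
  ext y
  obtain ⟨z, rfl⟩ := mk_surjective hk y
  exact h z

lemma ker_mk {i j k : ι} (hi : c.prev j = i) (hk : c.next j = k)
    {M : ModuleCat.{v} R} (φ : LinearMap.ker (K.d j k).hom →ₗ[R] M)
    (hφ' : ∀ z, φ z = 0 ↔ ∃ w : K.X i, (K.d i j).hom w = z.1) :
    LinearMap.ker (mk K j k hk) = LinearMap.ker φ := by
  ext z; rw [LinearMap.mem_ker, LinearMap.mem_ker, mk_eq_zero_iff hi hk, hφ']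

/-- A linear map on cycles which is surjective and whose kernel consists of the boundaries
identifies the homology with its target. -/
noncomputable def isoOfCycles {i j k : ι} (hi : c.prev j = i) (hk : c.next j = k)
    (M : ModuleCat.{v} R) (φ : LinearMap.ker (K.d j k).hom →ₗ[R] M)
    (hφ : Function.Surjective φ) (hφ' : ∀ z, φ z = 0 ↔ ∃ w : K.X i, (K.d i j).hom w = z.1) :
    K.homology j ≅ M :=
  (((mk K j k hk).quotKerEquivOfSurjective (mk_surjective hk)).symm ≪≫ₗ
    Submodule.quotEquivOfEq _ _ (ker_mk hi hk φ hφ') ≪≫ₗ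
    φ.quotKerEquivOfSurjective hφ).toModuleIso

lemma isoOfCycles_hom_mk {i j k : ι} (hi : c.prev j = i) (hk : c.next j = k)
    (M : ModuleCat.{v} R) (φ : LinearMap.ker (K.d j k).hom →ₗ[R] M)
    (hφ : Function.Surjective φ) (hφ' : ∀ z, φ z = 0 ↔ ∃ w : K.X i, (K.d i j).hom w = z.1)
    (z : LinearMap.ker (K.d j k).hom) :
    (isoOfCycles hi hk M φ hφ hφ').hom.hom (mk K j k hk z) = φ z := by
  have : ((mk K j k hk).quotKerEquivOfSurjective (mk_surjective hk)).symm (mk K j k hk z) =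
      Submodule.Quotient.mk z := by
    rw [LinearEquiv.symm_apply_eq]; rfl
  change φ.quotKerEquivOfSurjective hφ (Submodule.quotEquivOfEq _ _ (ker_mk hi hk φ hφ')
    (((mk K j k hk).quotKerEquivOfSurjective (mk_surjective hk)).symm (mk K j k hk z))) = _
  rw [this]
  rfl

end HomologyClass

/-- The shape of the differential of the `m`-th page: it has bidegree `(-m, 1 - m)`. -/
abbrev pageShape (m : ℤ) : ComplexShape (ℤ × ℤ) := ComplexShape.up' ((-m, 1 - m) : ℤ × ℤ)

/-- Spectral sequences of `R`-modules, with pages indexed by `m ≥ 0`. The `m`-th page is an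
`m`-bigraded complex. -/
abbrev SpSe (R : Type u) [CommRing R] :=
  CategoryTheory.SpectralSequence (ModuleCat.{v} R) pageShape 0

/-- A filtered complex of `R`-modules: an unbounded cochain complex with an increasing filtration
by subcomplexes, indexed by the integers. -/
structure FilteredComplex (R : Type u) [CommRing R] where
  K : CochainComplex (ModuleCat.{v} R) ℤ
  F (p n : ℤ) : Submodule R (K.X n)
  le_succ (p n : ℤ) : F (p - 1) n ≤ F p n
  d_mem (p n : ℤ) (x : K.X n) (hx : x ∈ F p n) : (K.d n (n + 1)).hom x ∈ F p (n + 1)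

namespace FilteredComplex

variable {R : Type u} [CommRing R]

/-- Morphisms of complexes compatible with the filtrations. -/
@[ext]
structure Hom (A B : FilteredComplex.{v} R) where
  f : A.K ⟶ B.K
  map_mem (p n : ℤ) (x : A.K.X n) (hx : x ∈ A.F p n) : (f.f n).hom x ∈ B.F p n

instance : Category (FilteredComplex.{v} R) where
  Hom := Hom
  id A := { f := 𝟙 A.K, map_mem := fun _ _ _ hx => hx }
  comp f g := { f := f.f ≫ g.f, map_mem := fun p n x hx => g.map_mem p n _ (f.map_mem p n x hx) }

/-- An `r`-homotopy from `f` to `g`: maps `h` of degree `-1` with `d h + h d = g - f` and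
`h (F_p A) ⊆ F_{p + r} B`. (The homotopies of Mathlib from `g` to `f` satisfy
`g = d h + h d + f`.) -/
structure RHomotopy (r : ℕ) {A B : FilteredComplex.{v} R} (f g : A ⟶ B) where
  h : Homotopy g.f f.f
  map_mem (p n n' : ℤ) (x : A.K.X n) (hx : x ∈ A.F p n) : (h.hom n n').hom x ∈ B.F (p + r) n'

variable (A B : FilteredComplex.{v} R)

lemma F_mono (n : ℤ) {p p' : ℤ} (h : p ≤ p') : A.F p n ≤ A.F p' n := by
  induction p', h using Int.leInduction with
  | base => exact le_rfl
  | succ k _ ih =>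
    have := A.le_succ (k + 1) n
    rw [add_sub_cancel_right] at this
    exact ih.trans this

lemma d_mem' {p n n' : ℤ} {x : A.K.X n} (hx : x ∈ A.F p n) : (A.K.d n n').hom x ∈ A.F p n' := by
  by_cases h : n + 1 = n'
  · subst h; exact A.d_mem p n x hx
  · rw [A.K.shape n n' h]; exact Submodule.zero_mem _

lemma d_d {n n' n'' : ℤ} (x : A.K.X n) : (A.K.d n' n'').hom ((A.K.d n n').hom x) = 0 := by
  rw [← LinearMap.comp_apply, ← ModuleCat.hom_comp, A.K.d_comp_d]; rfl

/-- The `m`-cycles of bidegree `(p, n + p)`: the submodule `F_p A^n ∩ d⁻¹ (F_{p - m} A^{n + 1})`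
of `A^n`. -/
def Zr (m p n : ℤ) : Submodule R (A.K.X n) :=
  A.F p n ⊓ (A.F (p - m) (n + 1)).comap (A.K.d n (n + 1)).hom

/-- The `m`-boundaries of bidegree `(p, n + p)`: the submodule
`Z_{m - 1}^{p - 1, n + p - 1} + d Z_{m - 1}^{p + m - 1, n + p + m - 2}` of `A^n`. For `m = 0` this is
`Z_0^{p - 1, n + p - 1} = F_{p - 1} A^n`, see `B_zero`. -/
def Br (m p n : ℤ) : Submodule R (A.K.X n) :=
  A.Zr (m - 1) (p - 1) n ⊔ (A.Zr (m - 1) (p + m - 1) (n - 1)).map (A.K.d (n - 1) n).hom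

variable {A B}

lemma mem_Z {m p n n' : ℤ} (h : n + 1 = n') {x : A.K.X n} :
    x ∈ A.Zr m p n ↔ x ∈ A.F p n ∧ (A.K.d n n').hom x ∈ A.F (p - m) n' := by
  subst h; rfl

lemma mem_B {m p n n₀ : ℤ} (h : n₀ + 1 = n) {x : A.K.X n} :
    x ∈ A.Br m p n ↔ ∃ y ∈ A.Zr (m - 1) (p - 1) n, ∃ w ∈ A.Zr (m - 1) (p + m - 1) n₀,
      y + (A.K.d n₀ n).hom w = x := by
  obtain rfl : n₀ = n - 1 := by lia
  simp only [Br, Submodule.mem_sup, Submodule.mem_map, exists_exists_and_eq_and]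

lemma Z_zero (p n : ℤ) : A.Zr 0 p n = A.F p n := by
  ext x
  rw [mem_Z rfl, sub_zero]
  exact ⟨fun h => h.1, fun h => ⟨h, A.d_mem' h⟩⟩

lemma B_zero (p n : ℤ) : A.Br 0 p n = A.Zr 0 (p - 1) n := by
  ext x
  rw [mem_B (sub_add_cancel n 1), Z_zero]
  constructor
  · rintro ⟨y, hy, w, hw, rfl⟩
    refine Submodule.add_mem _ hy.1 (A.d_mem' ?_)
    simpa using hw.1
  · intro h
    refine ⟨x, (mem_Z rfl).2 ⟨h, A.F_mono _ (by lia) (A.d_mem' h)⟩, 0, Submodule.zero_mem _, ?_⟩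
    rw [map_zero, add_zero]

lemma d_mem_Z {m p p' n n' : ℤ} (hp : p - m = p') (hn : n + 1 = n') {x : A.K.X n}
    (hx : x ∈ A.Zr m p n) : (A.K.d n n').hom x ∈ A.Zr m p' n' := by
  subst hp
  rw [mem_Z hn] at hx
  refine (mem_Z rfl).2 ⟨hx.2, ?_⟩
  rw [d_d]; exact Submodule.zero_mem _

lemma d_mem_B {m p p' n n' : ℤ} (hp : p - m = p') (hn : n + 1 = n') {x : A.K.X n}
    (hx : x ∈ A.Br m p n) : (A.K.d n n').hom x ∈ A.Br m p' n' := by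
  obtain ⟨y, hy, w, hw, rfl⟩ := (mem_B (sub_add_cancel n 1)).1 hx
  refine (mem_B hn).2 ⟨0, Submodule.zero_mem _, y, ?_, ?_⟩
  · convert hy using 2; lia
  · rw [map_add, d_d, add_zero, zero_add]

lemma map_mem_Z (f : A ⟶ B) {m p n : ℤ} {x : A.K.X n} (hx : x ∈ A.Zr m p n) :
    (f.f.f n).hom x ∈ B.Zr m p n := by
  refine ⟨f.map_mem _ _ _ hx.1, ?_⟩
  change (B.K.d n (n + 1)).hom ((f.f.f n).hom x) ∈ B.F (p - m) (n + 1)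
  rw [← LinearMap.comp_apply, ← ModuleCat.hom_comp, f.f.comm]
  exact f.map_mem _ _ _ hx.2

lemma map_mem_B (f : A ⟶ B) {m p n : ℤ} {x : A.K.X n} (hx : x ∈ A.Br m p n) :
    (f.f.f n).hom x ∈ B.Br m p n := by
  obtain ⟨y, hy, w, hw, rfl⟩ := (mem_B (sub_add_cancel n 1)).1 hx
  refine (mem_B (sub_add_cancel n 1)).2 ⟨_, map_mem_Z f hy, _, map_mem_Z f hw, ?_⟩
  rw [map_add, ← LinearMap.comp_apply, ← ModuleCat.hom_comp, f.f.comm]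
  rfl

variable (A B)

/-- `E_m^{p, q} = Z_m^{p, q} / B_m^{p, q}`, where `q = n + p`. -/
abbrev E (m : ℤ) (i : ℤ × ℤ) : Type v :=
  A.Zr m i.1 (i.2 - i.1) ⧸ (A.Br m i.1 (i.2 - i.1)).submoduleOf (A.Zr m i.1 (i.2 - i.1))

/-- The class `[a]_m` of an `m`-cycle `a`. -/
abbrev E.mk (m : ℤ) (i : ℤ × ℤ) : A.Zr m i.1 (i.2 - i.1) →ₗ[R] A.E m i :=
  ((A.Br m i.1 (i.2 - i.1)).submoduleOf (A.Zr m i.1 (i.2 - i.1))).mkQ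

lemma shape_fst {m : ℤ} {i j : ℤ × ℤ} (h : (pageShape m).Rel i j) : i.1 - m = j.1 := by
  have : i + (-m, 1 - m) = j := h
  rw [← this]; simp; lia

lemma shape_snd {m : ℤ} {i j : ℤ × ℤ} (h : (pageShape m).Rel i j) :
    (i.2 - i.1) + 1 = j.2 - j.1 := by
  have : i + (-m, 1 - m) = j := h
  rw [← this]; simp; lia

/-- The differential `δ_m [a]_m = [d a]_m`. -/
def E.d (m : ℤ) (i j : ℤ × ℤ) (h : (pageShape m).Rel i j) : A.E m i →ₗ[R] A.E m j :=
  Submodule.mapQ _ _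
    ((A.K.d (i.2 - i.1) (j.2 - j.1)).hom.restrict
      (fun _ hx => d_mem_Z (shape_fst h) (shape_snd h) hx))
    (fun _ hx => d_mem_B (shape_fst h) (shape_snd h) hx)

lemma E.d_mk {m : ℤ} {i j : ℤ × ℤ} (h : (pageShape m).Rel i j) (x : A.Zr m i.1 (i.2 - i.1)) :
    E.d A m i j h (E.mk A m i x) = E.mk A m j ⟨(A.K.d (i.2 - i.1) (j.2 - j.1)).hom x.1,
      d_mem_Z (shape_fst h) (shape_snd h) x.2⟩ := rfl

lemma E.mk_eq_zero {m : ℤ} {i : ℤ × ℤ} (x : A.Zr m i.1 (i.2 - i.1)) :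
    E.mk A m i x = 0 ↔ x.1 ∈ A.Br m i.1 (i.2 - i.1) :=
  Submodule.Quotient.mk_eq_zero _

/-- The `m`-th page of the spectral sequence of a filtered complex. -/
noncomputable def page (m : ℤ) : HomologicalComplex (ModuleCat.{v} R) (pageShape m) where
  X i := ModuleCat.of R (A.E m i)
  d i j := if h : (pageShape m).Rel i j then ModuleCat.ofHom (E.d A m i j h) else 0
  shape i j h := dif_neg h
  d_comp_d' i j k hij hjk := by
    rw [dif_pos hij, dif_pos hjk]
    ext x
    refine (E.mk_eq_zero A _).2 ?_
    change (A.K.d _ _).hom ((A.K.d _ _).hom x.1) ∈ _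
    rw [d_d]
    exact Submodule.zero_mem _

/-- The map induced by a morphism of filtered complexes on the `m`-th pages. -/
def E.map {A B : FilteredComplex.{v} R} (f : A ⟶ B) (m : ℤ) (i : ℤ × ℤ) : A.E m i →ₗ[R] B.E m i :=
  Submodule.mapQ _ _ ((f.f.f (i.2 - i.1)).hom.restrict (fun _ hx => map_mem_Z f hx))
    (fun _ hx => map_mem_B f hx)

lemma page_d_mk {m : ℤ} {i j : ℤ × ℤ} (h : (pageShape m).Rel i j) (x : A.Zr m i.1 (i.2 - i.1)) :
    ((A.page m).d i j).hom (E.mk A m i x) = E.mk A m j ⟨(A.K.d (i.2 - i.1) (j.2 - j.1)).hom x.1,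
      d_mem_Z (shape_fst h) (shape_snd h) x.2⟩ := by
  have : (A.page m).d i j = ModuleCat.ofHom (E.d A m i j h) := dif_pos h
  rw [this]; rfl

/-- The morphism of `m`-bigraded complexes induced by a morphism of filtered complexes. -/
noncomputable def pageMap {A B : FilteredComplex.{v} R} (f : A ⟶ B) (m : ℤ) :
    A.page m ⟶ B.page m where
  f i := ModuleCat.ofHom (E.map f m i)
  comm' i j h := by
    ext x
    obtain ⟨x, rfl⟩ := Submodule.mkQ_surjective _ x
    refine (page_d_mk B h _).trans (Eq.trans ?_ (congrArg (E.map f m j) (page_d_mk A h x)).symm)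
    refine congrArg (E.mk B m j) (Subtype.ext ?_)
    change (B.K.d _ _).hom ((f.f.f _).hom x.1) = (f.f.f _).hom ((A.K.d _ _).hom x.1)
    rw [← LinearMap.comp_apply, ← ModuleCat.hom_comp, f.f.comm]
    rfl

lemma next_eq (m : ℤ) (i : ℤ × ℤ) : (pageShape m).next i = i + (-m, 1 - m) :=
  (pageShape m).next_eq' rfl

lemma prev_eq (m : ℤ) (i : ℤ × ℤ) : (pageShape m).prev i = i - (-m, 1 - m) :=
  (pageShape m).prev_eq' (sub_add_cancel i _)

lemma Z_succ_le {m m' p n : ℤ} (hm : m ≤ m') : A.Zr m' p n ≤ A.Zr m p n :=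
  fun _ hx => ⟨hx.1, A.F_mono _ (by lia) hx.2⟩

/-- An `(m + 1)`-cycle `a` defines a cycle `[a]_m` of the `m`-th page. -/
noncomputable def toKer (m m' : ℤ) (hm : m + 1 = m') (i : ℤ × ℤ) :
    A.Zr m' i.1 (i.2 - i.1) →ₗ[R]
      LinearMap.ker ((A.page m).d i (i + (-m, 1 - m))).hom :=
  LinearMap.codRestrict _ (E.mk A m i ∘ₗ Submodule.inclusion (A.Z_succ_le (by lia))) (by
    intro x
    have hrel : (pageShape m).Rel i (i + (-m, 1 - m)) := rfl
    refine (page_d_mk A hrel _).trans ((E.mk_eq_zero A _).2 ?_)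
    refine (mem_B (shape_snd hrel)).2 ⟨(A.K.d (i.2 - i.1) _).hom x.1, ?_, 0,
      Submodule.zero_mem _, by rw [map_zero, add_zero]; rfl⟩
    refine (mem_Z rfl).2 ⟨?_, ?_⟩
    · have := ((mem_Z (shape_snd hrel)).1 x.2).2
      convert this using 2
      rw [← shape_fst hrel]; lia
    · rw [d_d]; exact Submodule.zero_mem _)

/-- An `(m + 1)`-cycle `a` defines the class of `[a]_m` in the homology of the `m`-th page. -/
noncomputable def toHomology (m m' : ℤ) (hm : m + 1 = m') (i : ℤ × ℤ) :
    A.Zr m' i.1 (i.2 - i.1) →ₗ[R] (A.page m).homology i :=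
  HomologyClass.mk (A.page m) i _ (next_eq m i) ∘ₗ A.toKer m m' hm i

lemma toHomology_surjective (m m' : ℤ) (hm : m + 1 = m') (i : ℤ × ℤ) :
    Function.Surjective (A.toHomology m m' hm i) := by
  intro y
  obtain ⟨⟨z, hz⟩, rfl⟩ := HomologyClass.mk_surjective (next_eq m i) y
  obtain ⟨x, rfl⟩ := Submodule.mkQ_surjective _ z
  have hrel : (pageShape m).Rel i (i + (-m, 1 - m)) := rfl
  have h0 := (E.mk_eq_zero A _).1 ((page_d_mk A hrel x).symm.trans hz)
  obtain ⟨y, hy, w, hw, h⟩ := (mem_B (shape_snd hrel)).1 h0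
  have e : (i + (-m, 1 - m)).1 + m - 1 = i.1 - 1 := by simp
  rw [e] at hw
  have hwZ : w ∈ A.Zr m i.1 (i.2 - i.1) :=
    ⟨A.F_mono _ (by lia) hw.1, A.F_mono _ (by lia) hw.2⟩
  have hmem : x.1 - w ∈ A.Zr m' i.1 (i.2 - i.1) := by
    refine (mem_Z (shape_snd hrel)).2 ⟨Submodule.sub_mem _ x.2.1 hwZ.1, ?_⟩
    rw [map_sub, sub_eq_of_eq_add h.symm]
    exact A.F_mono _ (by simp; lia) hy.1
  refine ⟨⟨_, hmem⟩, congrArg (HomologyClass.mk (A.page m) i _ (next_eq m i)) (Subtype.ext ?_)⟩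
  refine (Submodule.Quotient.eq _).2 ?_
  refine (mem_B (sub_add_cancel _ 1)).2 ⟨-w, Submodule.neg_mem _ hw, 0, Submodule.zero_mem _, ?_⟩
  change -w + _ = (x.1 - w) - x.1
  rw [map_zero]; abel

lemma ker_toHomology (m m' : ℤ) (hm : m + 1 = m') (i : ℤ × ℤ) :
    LinearMap.ker (A.toHomology m m' hm i) =
      (A.Br m' i.1 (i.2 - i.1)).submoduleOf (A.Zr m' i.1 (i.2 - i.1)) := by
  subst hm
  ext x
  have hrel : (pageShape m).Rel (i - (-m, 1 - m)) i := sub_add_cancel i _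
  have e1 := shape_fst hrel
  have e2 := shape_snd hrel
  rw [LinearMap.mem_ker]
  refine (HomologyClass.mk_eq_zero_iff (prev_eq m i) (next_eq m i) _).trans ?_
  change (∃ w, _ = E.mk A m i ⟨x.1, _⟩) ↔ x.1 ∈ A.Br (m + 1) i.1 (i.2 - i.1)
  rw [mem_B e2]
  generalize i - (-m, 1 - m) = k at *
  constructor
  · rintro ⟨w, hw⟩
    obtain ⟨w, rfl⟩ := Submodule.mkQ_surjective _ w
    have h0 := (Submodule.Quotient.eq _).1 ((page_d_mk A hrel w).symm.trans hw)
    obtain ⟨y, hy, w', hw', h⟩ := (mem_B e2).1 h0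
    change y + _ = (A.K.d _ _).hom w.1 - x.1 at h
    have hw'' : w.1 - w' ∈ A.Zr (m + 1 - 1) (i.1 + (m + 1) - 1) (k.2 - k.1) := by
      rw [mem_Z e2] at hw' ⊢
      have := (mem_Z e2).1 w.2
      refine ⟨Submodule.sub_mem _ (A.F_mono _ (by lia) this.1) (A.F_mono _ (by lia) hw'.1), ?_⟩
      rw [map_sub]
      exact Submodule.sub_mem _ (A.F_mono _ (by lia) this.2) (A.F_mono _ (by lia) hw'.2)
    have hy' : x.1 = -y + (A.K.d _ _).hom (w.1 - w') := by
      rw [map_sub]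
      have : x.1 = (A.K.d _ _).hom w.1 - (y + (A.K.d _ _).hom w') := by rw [h]; abel
      rw [this]; abel
    refine ⟨-y, ⟨Submodule.neg_mem _ hy.1, ?_⟩, _, hw'', hy'.symm⟩
    have : -y = x.1 - (A.K.d (k.2 - k.1) _).hom (w.1 - w') := by rw [hy']; abel
    rw [this]
    change (A.K.d _ _).hom _ ∈ A.F _ _
    rw [map_sub, d_d, sub_zero]
    exact A.F_mono _ (by lia) x.2.2
  · rintro ⟨y, hy, w, hw, h⟩
    have hw' : w ∈ A.Zr m k.1 (k.2 - k.1) := by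
      convert hw using 2 <;> lia
    refine ⟨E.mk A m k ⟨w, hw'⟩, (page_d_mk A hrel _).trans ?_⟩
    refine (Submodule.Quotient.eq _).2 ((mem_B e2).2 ⟨-y, ?_, 0, Submodule.zero_mem _, ?_⟩)
    · refine Submodule.neg_mem _ ⟨hy.1, ?_⟩
      have : y = x.1 - (A.K.d (k.2 - k.1) _).hom w := by rw [← h]; abel
      rw [this]
      change (A.K.d _ _).hom _ ∈ A.F _ _
      rw [map_sub, d_d, sub_zero]
      exact A.F_mono _ (by lia) x.2.2
    · change -y + _ = (A.K.d _ _).hom w - x.1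
      rw [map_zero, ← h]; abel

/-- The identification of `E_{m + 1}` with the homology of `E_m`: it sends `[a]_{m + 1}` to the
class of `[a]_m`. -/
noncomputable def isoHomology (m m' : ℤ) (hm : m + 1 = m') (i : ℤ × ℤ) :
    (A.page m).homology i ≅ (A.page m').X i :=
  ((Submodule.quotEquivOfEq _ _ (A.ker_toHomology m m' hm i)).symm ≪≫ₗ
    (A.toHomology m m' hm i).quotKerEquivOfSurjective
      (A.toHomology_surjective m m' hm i)).symm.toModuleIso

lemma isoHomology_inv_mk (m m' : ℤ) (hm : m + 1 = m') (i : ℤ × ℤ) (x : A.Zr m' i.1 (i.2 - i.1)) :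
    (A.isoHomology m m' hm i).inv.hom (E.mk A m' i x) = A.toHomology m m' hm i x := rfl

/-- The spectral sequence of a filtered complex. -/
noncomputable def spectralSequence : SpSe.{v} R where
  page m _ := A.page m
  iso m m' i hm _ := A.isoHomology m m' hm i

end FilteredComplex

open FilteredComplex in
/-- The spectral sequence functor from filtered complexes to spectral sequences. -/
noncomputable def spectralSequenceFunctor (R : Type u) [CommRing R] :
    FilteredComplex.{v} R ⥤ SpSe.{v} R where
  obj A := A.spectralSequence
  map {A B} f :=
    { hom := fun m _ => pageMap f m
      comm := fun m m' i hm _ => by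
        change HomologicalComplex.homologyMap (pageMap f m) i ≫ (B.isoHomology m m' hm i).hom =
          (A.isoHomology m m' hm i).hom ≫ (pageMap f m').f i
        rw [← Iso.eq_comp_inv, Category.assoc, ← Iso.inv_comp_eq]
        ext x
        obtain ⟨x, rfl⟩ := Submodule.mkQ_surjective _ x
        exact HomologyClass.map_mk (pageMap f m) (next_eq m i) (A.toKer m m' hm i x)
          (B.toKer m m' hm i ⟨_, map_mem_Z f x.2⟩) rfl }
  map_id A := by
    apply CategoryTheory.SpectralSequence.hom_ext
    intro m hm
    ext i x
    obtain ⟨x, rfl⟩ := Submodule.mkQ_surjective _ x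
    rfl
  map_comp f g := by
    apply CategoryTheory.SpectralSequence.hom_ext
    intro m hm
    ext i x
    obtain ⟨x, rfl⟩ := Submodule.mkQ_surjective _ x
    rfl

namespace SpSe

open FilteredComplex (next_eq prev_eq)

variable {R : Type u} [CommRing R] (r : ℕ)

/-- The bidegree `(p + r, q + r - 1)`, from which `u ⊗ -` reaches bidegree `(p, q)`. -/
abbrev shift (i : ℤ × ℤ) : ℤ × ℤ := (i.1 + r, i.2 + r - 1)

lemma shift_rel {m : ℤ} {i j : ℤ × ℤ} (h : (pageShape m).Rel i j) :
    (pageShape m).Rel (shift r i) (shift r j) := by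
  have : i + (-m, 1 - m) = j := h
  change shift r i + (-m, 1 - m) = shift r j
  rw [← this]; ext <;> simp <;> lia

variable {m : ℤ} (K : HomologicalComplex (ModuleCat.{v} R) (pageShape m))

/-- The part `A ⟶ u ⊗ A` of the differential of the path object coming from the differential of
`Λ_r`: since `i = shift r j` when `m = r` and `(pageShape m).Rel i j`, it is the identity
(up to the identification of `K.X i` with `K.X (shift r j)`) on the `r`-th page, and it vanishes
on the other pages. -/
noncomputable def conn (i j : ℤ × ℤ) : K.X i →ₗ[R] K.X (shift r j) :=
  if h : m = r ∧ i = shift r j then (K.XIsoOfEq h.2).hom.hom else 0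

/-- The differential `(x, y, z) ↦ (d x, - d y, d z)` for `m ≠ r`,
and `(x, y, z) ↦ (d x, - x - d y + z, d z)` for `m = r`. -/
noncomputable def lowD (i j : ℤ × ℤ) :
    (K.X i × K.X (shift r i) × K.X i) →ₗ[R] (K.X j × K.X (shift r j) × K.X j) :=
  LinearMap.prod
    ((K.d i j).hom ∘ₗ LinearMap.fst R _ _)
    (LinearMap.prod
      (-(conn r K i j ∘ₗ LinearMap.fst R _ _)
        - (K.d (shift r i) (shift r j)).hom ∘ₗ LinearMap.fst R _ _ ∘ₗ LinearMap.snd R _ _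
        + conn r K i j ∘ₗ LinearMap.snd R _ _ ∘ₗ LinearMap.snd R _ _)
      ((K.d i j).hom ∘ₗ LinearMap.snd R _ _ ∘ₗ LinearMap.snd R _ _))

lemma lowD_apply (i j : ℤ × ℤ) (x : K.X i) (y : K.X (shift r i)) (z : K.X i) :
    lowD r K i j (x, y, z) = ((K.d i j).hom x,
      -(conn r K i j x) - (K.d (shift r i) (shift r j)).hom y + conn r K i j z,
      (K.d i j).hom z) := rfl

lemma d_d {ι : Type*} {c : ComplexShape ι} (K : HomologicalComplex (ModuleCat.{v} R) c)
    (i j k : ι) (x : K.X i) : (K.d j k).hom ((K.d i j).hom x) = 0 := by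
  rw [← LinearMap.comp_apply, ← ModuleCat.hom_comp, K.d_comp_d]; rfl

lemma d_conn {i j k : ℤ × ℤ} (hij : (pageShape m).Rel i j) (hjk : (pageShape m).Rel j k)
    (x : K.X i) : (K.d (shift r j) (shift r k)).hom (conn r K i j x) =
      conn r K j k ((K.d i j).hom x) := by
  by_cases hm : m = r
  · have h1 : i = shift r j := by
      have : i + (-m, 1 - m) = j := hij
      rw [← this]; ext <;> simp [hm] <;> ring
    have h2 : j = shift r k := by
      have : j + (-m, 1 - m) = k := hjk
      rw [← this]; ext <;> simp [hm] <;> ring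
    rw [conn, conn, dif_pos ⟨hm, h1⟩, dif_pos ⟨hm, h2⟩]
    rw [← LinearMap.comp_apply, ← LinearMap.comp_apply, ← ModuleCat.hom_comp, ← ModuleCat.hom_comp,
      K.XIsoOfEq_hom_comp_d, K.d_comp_XIsoOfEq_hom]
  · rw [conn, conn, dif_neg (fun h => hm h.1), dif_neg (fun h => hm h.1)]
    simp

/-- The `m`-th page of the path object for `m ≤ r`: in bidegree `(p, q)` it consists of the triples
`e₋ ⊗ x + u ⊗ y + e₊ ⊗ z`, with `x, z` of bidegree `(p, q)` and `y` of bidegree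
`(p + r, q + r - 1)`. -/
noncomputable def lowPage : HomologicalComplex (ModuleCat.{v} R) (pageShape m) where
  X i := ModuleCat.of R (K.X i × K.X (shift r i) × K.X i)
  d i j := open Classical in
    if (pageShape m).Rel i j then ModuleCat.ofHom (lowD r K i j) else 0
  shape i j h := if_neg h
  d_comp_d' i j k hij hjk := by
    rw [if_pos hij, if_pos hjk, ← ModuleCat.ofHom_comp]
    refine congrArg ModuleCat.ofHom (LinearMap.ext fun ⟨x, y, z⟩ => ?_)
    change lowD r K j k (lowD r K i j (x, y, z)) = 0
    rw [lowD_apply, lowD_apply, d_d, d_d, map_add, map_sub, map_neg, d_d, d_conn r K hij hjk,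
      d_conn r K hij hjk]
    ext <;> simp

lemma lowPage_d {i j : ℤ × ℤ} (h : (pageShape m).Rel i j) (w : K.X i × K.X (shift r i) × K.X i) :
    ((lowPage r K).d i j).hom w = lowD r K i j w := by
  have : (lowPage r K).d i j = ModuleCat.ofHom (lowD r K i j) := if_pos h
  rw [this]; rfl

/-- The projection `(x, y, z) ↦ x`. -/
noncomputable def lowFst : lowPage r K ⟶ K where
  f i := ModuleCat.ofHom (LinearMap.fst R _ _)
  comm' i j h := by
    ext w
    exact (congrArg Prod.fst (lowPage_d r K h w)).symm

/-- The projection `(x, y, z) ↦ z`. -/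
noncomputable def lowSnd : lowPage r K ⟶ K where
  f i := ModuleCat.ofHom (LinearMap.snd R _ _ ∘ₗ LinearMap.snd R _ _)
  comm' i j h := by
    ext w
    exact (congrArg (fun t => t.2.2) (lowPage_d r K h w)).symm

lemma conn_of_ne (hm : m ≠ r) (i j : ℤ × ℤ) : conn r K i j = 0 := dif_neg (fun h => hm h.1)

lemma next_shift (m : ℤ) (i : ℤ × ℤ) :
    (pageShape m).next (shift r i) = shift r (i + (-m, 1 - m)) :=
  (pageShape m).next_eq' (shift_rel r (j := i + (-m, 1 - m)) rfl)

lemma prev_shift (m : ℤ) (i : ℤ × ℤ) :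
    (pageShape m).prev (shift r i) = shift r (i - (-m, 1 - m)) :=
  (pageShape m).prev_eq' (shift_rel r (i := i - (-m, 1 - m)) (sub_add_cancel i _))

/-- The first component of a cycle of the path object. -/
noncomputable def cycFst (i : ℤ × ℤ) :
    LinearMap.ker ((lowPage r K).d i (i + (-m, 1 - m))).hom →ₗ[R]
      LinearMap.ker (K.d i (i + (-m, 1 - m))).hom :=
  LinearMap.codRestrict _ (LinearMap.fst R (K.X i) (K.X (shift r i) × K.X i) ∘ₗ
    Submodule.subtype _)
    (fun w => congrArg Prod.fst ((lowPage_d r K rfl w.1).symm.trans w.2))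

/-- The third component of a cycle of the path object. -/
noncomputable def cycSnd (i : ℤ × ℤ) :
    LinearMap.ker ((lowPage r K).d i (i + (-m, 1 - m))).hom →ₗ[R]
      LinearMap.ker (K.d i (i + (-m, 1 - m))).hom :=
  LinearMap.codRestrict _ (LinearMap.snd R (K.X (shift r i)) (K.X i) ∘ₗ
    LinearMap.snd R (K.X i) (K.X (shift r i) × K.X i) ∘ₗ Submodule.subtype _)
    (fun w => congrArg (fun t : K.X _ × K.X (shift r _) × K.X _ => t.2.2) ((lowPage_d r K rfl w.1).symm.trans w.2))

/-- The middle component of a cycle of the path object, for `m ≠ r`. -/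
noncomputable def cycMid (hm : m ≠ r) (i : ℤ × ℤ) :
    LinearMap.ker ((lowPage r K).d i (i + (-m, 1 - m))).hom →ₗ[R]
      LinearMap.ker (K.d (shift r i) (shift r (i + (-m, 1 - m)))).hom :=
  LinearMap.codRestrict _ (LinearMap.fst R (K.X (shift r i)) (K.X i) ∘ₗ
    LinearMap.snd R (K.X i) (K.X (shift r i) × K.X i) ∘ₗ Submodule.subtype _) (fun w => by
      have h := congrArg (fun t => t.2.1) ((lowPage_d r K rfl w.1).symm.trans w.2)
      change -(conn r K _ _ w.1.1) - (K.d _ _).hom w.1.2.1 + conn r K _ _ w.1.2.2 = 0 at h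
      rw [conn_of_ne r K hm, LinearMap.zero_apply, LinearMap.zero_apply, neg_zero, zero_sub,
        add_zero, neg_eq_zero] at h
      exact h)

variable {m' : ℤ} {K} {K' : HomologicalComplex (ModuleCat.{v} R) (pageShape m')}
  (ψ : ∀ i, K.homology i ≅ K'.X i)

/-- The map sending a cycle to its class in the next page. -/
noncomputable def cls {i k : ℤ × ℤ} (hk : (pageShape m).next i = k) :
    LinearMap.ker (K.d i k).hom →ₗ[R] K'.X i :=
  (ψ i).hom.hom ∘ₗ HomologyClass.mk K i k hk

lemma cls_surjective {i k : ℤ × ℤ} (hk : (pageShape m).next i = k) :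
    Function.Surjective (cls ψ hk) :=
  (ψ i).toLinearEquiv.surjective.comp (HomologyClass.mk_surjective hk)

lemma cls_eq_zero_iff {i j k : ℤ × ℤ} (hj : (pageShape m).prev i = j)
    (hk : (pageShape m).next i = k) (z : LinearMap.ker (K.d i k).hom) :
    cls ψ hk z = 0 ↔ ∃ w : K.X j, (K.d j i).hom w = z.1 := by
  rw [← HomologyClass.mk_eq_zero_iff hj hk]
  exact (ψ i).toLinearEquiv.map_eq_zero_iff

/-- For `m < r`, the map `(x, y, z) ↦ ([x], [y], [z])` from cycles to the next page. -/
noncomputable def ltClass (hm : m ≠ r) (i : ℤ × ℤ) :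
    LinearMap.ker ((lowPage r K).d i (i + (-m, 1 - m))).hom →ₗ[R] (lowPage r K').X i :=
  LinearMap.prod (cls ψ (next_eq m i) ∘ₗ cycFst r K i)
    (LinearMap.prod (cls ψ (next_shift r m i) ∘ₗ cycMid r K hm i)
      (cls ψ (next_eq m i) ∘ₗ cycSnd r K i))

/-- For `m < r`, the characteristic map of the path object, sending the class of a cycle
`(x, y, z)` to `([x], [y], [z])`. -/
noncomputable def isoLt (hm : m ≠ r) (i : ℤ × ℤ) :
    (lowPage r K).homology i ≅ (lowPage r K').X i :=
  HomologyClass.isoOfCycles (prev_eq m i) (next_eq m i) _ (ltClass r ψ hm i) (by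
      rintro ⟨x, y, z⟩
      obtain ⟨⟨x, hx⟩, rfl⟩ := cls_surjective ψ (next_eq m i) x
      obtain ⟨⟨y, hy⟩, rfl⟩ := cls_surjective ψ (next_shift r m i) y
      obtain ⟨⟨z, hz⟩, rfl⟩ := cls_surjective ψ (next_eq m i) z
      rw [LinearMap.mem_ker] at hx hy hz
      refine ⟨⟨(x, y, z), ?_⟩, rfl⟩
      refine (lowPage_d r K rfl _).trans ?_
      rw [lowD_apply, hx, hy, hz, conn_of_ne r K hm]
      refine Prod.ext ?_ (Prod.ext ?_ ?_) <;> simp <;> rfl)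
    (by
      intro w
      have hrel : (pageShape m).Rel (i - (-m, 1 - m)) i := sub_add_cancel i _
      have e : ltClass r ψ hm i w = 0 ↔ cls ψ (next_eq m i) (cycFst r K i w) = 0 ∧
          cls ψ (next_shift r m i) (cycMid r K hm i w) = 0 ∧
          cls ψ (next_eq m i) (cycSnd r K i w) = 0 :=
        Prod.ext_iff.trans (and_congr_right fun _ => Prod.ext_iff)
      rw [e, cls_eq_zero_iff ψ (prev_eq m i), cls_eq_zero_iff ψ (prev_shift r m i),
        cls_eq_zero_iff ψ (prev_eq m i)]
      constructor
      · rintro ⟨⟨x, hx⟩, ⟨y, hy⟩, ⟨z, hz⟩⟩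
        refine ⟨(x, -y, z), (lowPage_d r K hrel _).trans ?_⟩
        rw [lowD_apply, hx, hz, map_neg, hy, conn_of_ne r K hm, LinearMap.zero_apply,
          LinearMap.zero_apply, neg_zero, zero_sub, neg_neg, add_zero]
        rfl
      · rintro ⟨⟨x, y, z⟩, h⟩
        replace h := (lowPage_d r K hrel _).symm.trans h
        rw [lowD_apply, conn_of_ne r K hm, LinearMap.zero_apply,
          LinearMap.zero_apply, neg_zero, zero_sub, add_zero] at h
        exact ⟨⟨x, congrArg Prod.fst h⟩, ⟨-y, by
          rw [map_neg]; exact congrArg (fun t => t.2.1) h⟩, ⟨z, congrArg (fun t => t.2.2) h⟩⟩)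

lemma conn_self_bijective (hm : m = r) {i j : ℤ × ℤ} (h : (pageShape m).Rel i j) :
    Function.Bijective (conn r K i j) := by
  have h1 : i = shift r j := by
    have : i + (-m, 1 - m) = j := h
    rw [← this]; ext <;> simp [hm] <;> ring
  rw [conn, dif_pos ⟨hm, h1⟩]
  exact (K.XIsoOfEq h1).toLinearEquiv.bijective

/-- On the `r`-th page, the characteristic map of the path object, sending the class of a cycle
`(x, y, z)` (so `x` and `z` are homologous cycles) to `[x]`. -/
noncomputable def isoEq (hm : m = r) (i : ℤ × ℤ) :
    (lowPage r K).homology i ≅ K'.X i :=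
  HomologyClass.isoOfCycles (prev_eq m i) (next_eq m i) _
    (cls ψ (next_eq m i) ∘ₗ cycFst r K i) (by
      intro x
      obtain ⟨⟨x, hx⟩, rfl⟩ := cls_surjective ψ (next_eq m i) x
      rw [LinearMap.mem_ker] at hx
      refine ⟨⟨(x, 0, x), ?_⟩, rfl⟩
      refine (lowPage_d r K rfl _).trans ?_
      rw [lowD_apply, hx]
      refine Prod.ext ?_ (Prod.ext ?_ ?_) <;> simp <;> rfl)
    (by
      rintro ⟨⟨x, y, z⟩, hw⟩
      have hrel : (pageShape m).Rel (i - (-m, 1 - m)) i := sub_add_cancel i _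
      replace hw := (lowPage_d r K rfl _).symm.trans hw
      refine (cls_eq_zero_iff ψ (prev_eq m i) _ _).trans ?_
      constructor
      · rintro ⟨x', hx⟩
        change _ = x at hx
        obtain ⟨t, rfl⟩ := (conn_self_bijective (K := K) r hm hrel).2 y
        refine ⟨(x', 0, x' + t), (lowPage_d r K hrel _).trans ?_⟩
        have h2 := congrArg (fun t => t.2.1) hw
        change -(conn r K _ _ x) - (K.d (shift r i) (shift r (i + (-m, 1 - m)))).hom
          (conn r K (i - (-m, 1 - m)) i t) + conn r K _ _ z = 0 at h2
        rw [d_conn r K hrel rfl, ← map_neg, ← map_sub, ← map_add] at h2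
        have h3 := (conn_self_bijective (K := K) r hm (i := i) rfl).1 (h2.trans (map_zero _).symm)
        rw [lowD_apply, map_add, map_zero, map_add, hx]
        refine Prod.ext ?_ (Prod.ext ?_ ?_)
        · rfl
        · change -_ - 0 + (_ + _) = conn r K _ _ t
          abel
        · change x + _ = z
          rw [← sub_eq_zero, ← neg_eq_zero, ← h3]; abel
      · rintro ⟨⟨x', y', z'⟩, h⟩
        exact ⟨x', congrArg Prod.fst ((lowPage_d r K hrel _).symm.trans h)⟩)

variable (A : SpSe.{v} R)

/-- The `m`-th page of the path object. -/
noncomputable def pathPage (m : ℤ) (hm : 0 ≤ m) :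
    HomologicalComplex (ModuleCat.{v} R) (pageShape m) :=
  if m ≤ r then lowPage r (A.page m hm) else A.page m hm

lemma pathPage_of_le {m : ℤ} (hm : 0 ≤ m) (h : m ≤ r) :
    pathPage r A m hm = lowPage r (A.page m hm) := if_pos h

lemma pathPage_of_lt {m : ℤ} (hm : 0 ≤ m) (h : r < m) :
    pathPage r A m hm = A.page m hm := if_neg (not_le.2 h)

/-- The identification of `pathPage r A m` with the complex of triples, for `m ≤ r`. -/
noncomputable def lowIso {m : ℤ} (hm : 0 ≤ m) (h : m ≤ r) :
    pathPage r A m hm ≅ lowPage r (A.page m hm) := eqToIso (pathPage_of_le r A hm h)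

/-- The identification of `pathPage r A m` with `A.page m`, for `m > r`. -/
noncomputable def highIso {m : ℤ} (hm : 0 ≤ m) (h : r < m) :
    pathPage r A m hm ≅ A.page m hm := eqToIso (pathPage_of_lt r A hm h)

/-- The characteristic maps of the path object. -/
noncomputable def pathIso (m m' : ℤ) (i : ℤ × ℤ) (h : m + 1 = m') (hm : 0 ≤ m) :
    (pathPage r A m hm).homology i ≅ (pathPage r A m' (by lia)).X i :=
  if h₁ : m < r then
    HomologicalComplex.homologyMapIso (lowIso r A hm h₁.le) i ≪≫
      isoLt r (fun i => A.iso m m' i h hm) h₁.ne i ≪≫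
      (HomologicalComplex.Hom.isoApp (lowIso r A (by lia) (by lia)) i).symm
  else if h₂ : m = r then
    HomologicalComplex.homologyMapIso (lowIso r A hm h₂.le) i ≪≫
      isoEq r (fun i => A.iso m m' i h hm) h₂ i ≪≫
      (HomologicalComplex.Hom.isoApp (highIso r A (by lia) (by lia)) i).symm
  else
    HomologicalComplex.homologyMapIso (highIso r A hm (by lia)) i ≪≫
      A.iso m m' i h hm ≪≫
      (HomologicalComplex.Hom.isoApp (highIso r A (by lia) (by lia)) i).symm

/-- The `r`-path `P(r; A) = Λ_r ⊗ A` of a spectral sequence `A`. Here `Λ_r` is the spectral sequence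
`R e₋ ⊕ R e₊ ⊕ R u` with `e₋, e₊` in bidegree `(0, 0)` and `u` in bidegree `(-r, 1 - r)`, whose only
nonzero differential is `d_r e₋ = -u`, `d_r e₊ = u`, and the tensor product has the differential
`d (a ⊗ b) = d a ⊗ b + (-1) ^ |a| a ⊗ d b`, where an element of bidegree `(p, q)` has
degree `q - p` (all differentials raise this degree by one). -/
noncomputable def path : SpSe.{v} R where
  page m hm := pathPage r A m hm
  iso m m' i h hm := pathIso r A m m' i h hm

lemma isoLt_hom_fst (hm : m ≠ r) (i : ℤ × ℤ) :
    (isoLt r ψ hm i).hom ≫ (lowFst r K').f i =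
      HomologicalComplex.homologyMap (lowFst r K) i ≫ (ψ i).hom := by
  refine HomologyClass.hom_ext (next_eq m i) fun w => ?_
  refine (congrArg Prod.fst (HomologyClass.isoOfCycles_hom_mk _ _ _ _ _ _ w)).trans ?_
  exact (congrArg (ψ i).hom.hom (HomologyClass.map_mk (lowFst r K) (next_eq m i) w
    (cycFst r K i w) rfl)).symm

lemma isoLt_hom_snd (hm : m ≠ r) (i : ℤ × ℤ) :
    (isoLt r ψ hm i).hom ≫ (lowSnd r K').f i =
      HomologicalComplex.homologyMap (lowSnd r K) i ≫ (ψ i).hom := by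
  refine HomologyClass.hom_ext (next_eq m i) fun w => ?_
  refine (congrArg (fun t : K'.X i × K'.X (shift r i) × K'.X i => t.2.2) (HomologyClass.isoOfCycles_hom_mk _ _ _ _ _ _ w)).trans ?_
  exact (congrArg (ψ i).hom.hom (HomologyClass.map_mk (lowSnd r K) (next_eq m i) w
    (cycSnd r K i w) rfl)).symm

lemma isoEq_hom_fst (hm : m = r) (i : ℤ × ℤ) :
    (isoEq r ψ hm i).hom = HomologicalComplex.homologyMap (lowFst r K) i ≫ (ψ i).hom := by
  refine HomologyClass.hom_ext (next_eq m i) fun w => ?_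
  refine (HomologyClass.isoOfCycles_hom_mk _ _ _ _ _ _ w).trans ?_
  exact (congrArg (ψ i).hom.hom (HomologyClass.map_mk (lowFst r K) (next_eq m i) w
    (cycFst r K i w) rfl)).symm

lemma isoEq_hom_snd (hm : m = r) (i : ℤ × ℤ) :
    (isoEq r ψ hm i).hom = HomologicalComplex.homologyMap (lowSnd r K) i ≫ (ψ i).hom := by
  refine HomologyClass.hom_ext (next_eq m i) fun w => ?_
  refine (HomologyClass.isoOfCycles_hom_mk _ _ _ _ _ _ w).trans ?_
  refine Eq.trans ?_ (congrArg (ψ i).hom.hom (HomologyClass.map_mk (lowSnd r K) (next_eq m i) w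
    (cycSnd r K i w) rfl)).symm
  have hrel : (pageShape m).Rel (i - (-m, 1 - m)) i := sub_add_cancel i _
  change cls ψ (next_eq m i) (cycFst r K i w) = cls ψ (next_eq m i) (cycSnd r K i w)
  rw [← sub_eq_zero, ← map_sub, cls_eq_zero_iff ψ (prev_eq m i)]
  obtain ⟨⟨x, y, z⟩, hw⟩ := w
  replace hw := (lowPage_d r K rfl _).symm.trans hw
  obtain ⟨t, rfl⟩ := (conn_self_bijective (K := K) r hm hrel).2 y
  have h2 := congrArg (fun t => t.2.1) hw
  change -(conn r K _ _ x) - (K.d (shift r i) (shift r (i + (-m, 1 - m)))).hom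
    (conn r K (i - (-m, 1 - m)) i t) + conn r K _ _ z = 0 at h2
  rw [d_conn r K hrel rfl, ← map_neg, ← map_sub, ← map_add] at h2
  have h3 := (conn_self_bijective (K := K) r hm (i := i) rfl).1 (h2.trans (map_zero _).symm)
  refine ⟨-t, ?_⟩
  change _ = x - z
  rw [map_neg, ← sub_eq_zero, ← h3]; abel

/-- The projection `∂⁻` of the path object on the `m`-th page: `(x, y, z) ↦ x` for `m ≤ r`, and the
identity for `m > r`. -/
noncomputable def pathFstPage (m : ℤ) (hm : 0 ≤ m) : pathPage r A m hm ⟶ A.page m hm :=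
  if h : m ≤ r then (lowIso r A hm h).hom ≫ lowFst r (A.page m hm)
  else (highIso r A hm (not_le.1 h)).hom

/-- The projection `∂⁺` of the path object on the `m`-th page: `(x, y, z) ↦ z` for `m ≤ r`, and the
identity for `m > r`. -/
noncomputable def pathSndPage (m : ℤ) (hm : 0 ≤ m) : pathPage r A m hm ⟶ A.page m hm :=
  if h : m ≤ r then (lowIso r A hm h).hom ≫ lowSnd r (A.page m hm)
  else (highIso r A hm (not_le.1 h)).hom

/-- The morphism `∂⁻ : P(r; A) ⟶ A`. -/
noncomputable def pathFst : path r A ⟶ A where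
  hom m hm := pathFstPage r A m hm
  comm m m' i h hm := by
    change HomologicalComplex.homologyMap (pathFstPage r A m hm) i ≫ (A.iso m m' i h hm).hom =
      (pathIso r A m m' i h hm).hom ≫ (pathFstPage r A m' (by lia)).f i
    unfold pathIso pathFstPage
    rcases lt_trichotomy m (r : ℤ) with h₁ | h₁ | h₁
    · rw [dif_pos h₁, dif_pos h₁.le, dif_pos (by lia : m' ≤ r)]
      simp [HomologicalComplex.homologyMap_comp, isoLt_hom_fst]
    · rw [dif_neg (by lia : ¬ m < r), dif_pos h₁, dif_pos h₁.le, dif_neg (by lia : ¬ m' ≤ r)]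
      simp [HomologicalComplex.homologyMap_comp, isoEq_hom_fst]
    · rw [dif_neg (by lia : ¬ m < r), dif_neg (by lia : ¬ m = r), dif_neg (by lia : ¬ m ≤ r),
        dif_neg (by lia : ¬ m' ≤ r)]
      simp

/-- The morphism `∂⁺ : P(r; A) ⟶ A`. -/
noncomputable def pathSnd : path r A ⟶ A where
  hom m hm := pathSndPage r A m hm
  comm m m' i h hm := by
    change HomologicalComplex.homologyMap (pathSndPage r A m hm) i ≫ (A.iso m m' i h hm).hom =
      (pathIso r A m m' i h hm).hom ≫ (pathSndPage r A m' (by lia)).f i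
    unfold pathIso pathSndPage
    rcases lt_trichotomy m (r : ℤ) with h₁ | h₁ | h₁
    · rw [dif_pos h₁, dif_pos h₁.le, dif_pos (by lia : m' ≤ r)]
      simp [HomologicalComplex.homologyMap_comp, isoLt_hom_snd]
    · rw [dif_neg (by lia : ¬ m < r), dif_pos h₁, dif_pos h₁.le, dif_neg (by lia : ¬ m' ≤ r)]
      simp [HomologicalComplex.homologyMap_comp, isoEq_hom_snd]
    · rw [dif_neg (by lia : ¬ m < r), dif_neg (by lia : ¬ m = r), dif_neg (by lia : ¬ m ≤ r),
        dif_neg (by lia : ¬ m' ≤ r)]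
      simp

/-- An `r`-homotopy from `f` to `g`: a morphism `h : A ⟶ P(r; B)` with `∂⁻ h = f` and
`∂⁺ h = g`. -/
structure RHomotopy {A B : SpSe.{v} R} (f g : A ⟶ B) where
  h : A ⟶ path r B
  fst : h ≫ pathFst r B = f
  snd : h ≫ pathSnd r B = g

end SpSe

/-! ### Cycles, representatives of homology classes, and transport along the identifications. -/

namespace FilteredComplex

variable {R : Type u} [CommRing R] {A B : FilteredComplex.{v} R}

/-! Let `h` be the given homotopy, so that `d h + h d = g - f` and `h` raises the filtration by at
most `r`. For `m ≤ r` the path object is reached by `[a] ↦ ([f a], [h a], [g a])`; for `m > r` its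
page is that of `B` itself, and `E(f)` is used.

Why this works: if `m ≤ r`, then `g - f`, which preserves the filtration, may be absorbed into the
jump `r - m`. Hence `h` carries `Z_m` and `B_m` in filtration `p` into those in filtration `p + r`
(`RHomotopy.map_mem_Z`, `RHomotopy.map_mem_B`), and `[a] ↦ [h a]` is well defined. Compatibility
with the middle component of `D_m` is `midMap_d`. For `m = r` it is the homotopy identity itself.
For `m < r` it needs `-[d h a] = [h d a]`, which holds because the difference `(g - f) a` then lies
in a filtration low enough to be an `m`-boundary.

The characteristic maps are given on representatives, so below page `r` they are respected
componentwise (`lowMap_comm`). At page `r` the characteristic map of the path object reads off the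
first component, and the square reduces to the one for `f`.

The first projection returns `E(f)` by construction. The second returns `E(g)` because `E(f)` and
`E(g)` coincide on all pages beyond `r` (`pageMap_eq`): there `h d a + d h a` is an `m`-boundary. -/

lemma XIsoOfEq_mem_Z {m p p' n n' : ℤ} (hp : p = p') (e : n = n') {x : B.K.X n}
    (hx : x ∈ B.Zr m p n) : (B.K.XIsoOfEq e).hom.hom x ∈ B.Zr m p' n' := by
  subst hp e; simpa using hx

/-- The two inequalities match the two filtration conditions that define a cycle. No order between
`m` and `m'` is imposed: the terms of `Br` have index `m - 1`, so `m` and `p` have to move together.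
-/
lemma Z_mono {m m' p p' n : ℤ} (hp : p ≤ p') (hpm : p - m ≤ p' - m') :
    B.Zr m p n ≤ B.Zr m' p' n :=
  fun _ hx => ⟨B.F_mono _ hp hx.1, B.F_mono _ hpm hx.2⟩

/-- The inverse of the characteristic map is explicit on representatives, and this inverts it.
Leaving `k` and `z` free makes it apply to the shifted bidegree of the middle component as well. -/
lemma isoHomology_hom_mk (m m' : ℤ) (hm : m + 1 = m') {i k : ℤ × ℤ}
    (hk : (pageShape m).next i = k) (x : A.Zr m' i.1 (i.2 - i.1))
    (z : LinearMap.ker ((A.page m).d i k).hom)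
    (hz : z.1 = E.mk A m i ⟨x.1, A.Z_succ_le (by lia) x.2⟩) :
    (A.isoHomology m m' hm i).hom.hom (HomologyClass.mk (A.page m) i k hk z) =
      E.mk A m' i x := by
  obtain rfl := hk.symm.trans (next_eq m i)
  obtain rfl : z = A.toKer m m' hm i x := Subtype.ext hz
  exact (congrArg (A.isoHomology m m' hm i).hom.hom (A.isoHomology_inv_mk m m' hm i x).symm).trans
    ((A.isoHomology m m' hm i).toLinearEquiv.apply_symm_apply _)

/-- The pages of the path object are defined by cases, so its characteristic maps are conjugated by
the identifications `e` and `e'`. These cancel, and only a square between the concrete complexes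
remains to be checked. -/
lemma homologyMap_comp_inv_comp {ι : Type*} {c c' : ComplexShape ι}
    {K L P : HomologicalComplex (ModuleCat.{v} R) c}
    {K' L' P' : HomologicalComplex (ModuleCat.{v} R) c'}
    (φ : K ⟶ L) (e : P ≅ L) (φ' : K' ⟶ L') (e' : P' ≅ L') {i : ι}
    (σ : K.homology i ≅ K'.X i) (τ : L.homology i ≅ L'.X i)
    (h : HomologicalComplex.homologyMap φ i ≫ τ.hom = σ.hom ≫ φ'.f i) :
    HomologicalComplex.homologyMap (φ ≫ e.inv) i ≫
      (HomologicalComplex.homologyMapIso e i ≪≫ τ ≪≫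
        (HomologicalComplex.Hom.isoApp e' i).symm).hom = σ.hom ≫ (φ' ≫ e'.inv).f i := by
  simp only [HomologicalComplex.comp_f, ← reassoc_of% h]
  simp [HomologicalComplex.homologyMap_comp, ← HomologicalComplex.homologyMap_comp_assoc]

lemma comp_inv_comp_hom_comp {C : Type*} [Category* C] {W X Y Z : C} (a : W ⟶ X) (e : Y ≅ X)
    (b : X ⟶ Z) : (a ≫ e.inv) ≫ e.hom ≫ b = a ≫ b := by
  simp

lemma comp_inv_comp_hom {C : Type*} [Category* C] {W X Y : C} (a : W ⟶ X) (e : Y ≅ X) :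
    (a ≫ e.inv) ≫ e.hom = a := by
  simp

/-! ### Effect of a homotopy on cycles and boundaries. -/

namespace RHomotopy

variable {r : ℕ} {f g : A ⟶ B} (H : RHomotopy r f g)
include H

/-- The identity `h d + d h = g - f`. -/
lemma hom_d_add_d_hom {n₀ n n₁ n' : ℤ} (h₀ : n₀ + 1 = n) (h₁ : n + 1 = n₁) (e : n = n')
    (a : A.K.X n) :
    (H.h.hom n₁ n').hom ((A.K.d n n₁).hom a) + (B.K.d n₀ n').hom ((H.h.hom n n₀).hom a) =
      (B.K.XIsoOfEq e).hom.hom ((g.f.f n).hom a - (f.f.f n).hom a) := by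
  -- The separate index `n'` is for `midMap_d`, where the degrees of `i` and `shift r j` are equal
  -- but not definitionally; after substitution the transport is the identity.
  subst e
  have h := H.h.comm n
  rw [dNext_eq _ (show (ComplexShape.up ℤ).Rel n n₁ from h₁),
    prevD_eq _ (show (ComplexShape.up ℤ).Rel n₀ n from h₀)] at h
  replace h := congrArg (fun t => t.hom a) h
  change (g.f.f n).hom a = (H.h.hom n₁ n).hom ((A.K.d n n₁).hom a) +
    (B.K.d n₀ n).hom ((H.h.hom n n₀).hom a) + (f.f.f n).hom a at h
  rw [h, add_sub_cancel_right]
  simp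

lemma hom_d_add_d_hom' {n₀ n n₁ : ℤ} (h₀ : n₀ + 1 = n) (h₁ : n + 1 = n₁) (a : A.K.X n) :
    (H.h.hom n₁ n).hom ((A.K.d n n₁).hom a) + (B.K.d n₀ n).hom ((H.h.hom n n₀).hom a) =
      (g.f.f n).hom a - (f.f.f n).hom a :=
  (H.hom_d_add_d_hom h₀ h₁ rfl a).trans (by simp)

/-- Write `d h a = (g - f) a - h d a`. The first term lies in `F_p`, hence in `F_(p + r - m)`
because `m ≤ r`; the second lies there because `d a ∈ F_(p - m)`. -/
lemma map_mem_Z {m p p' n n' : ℤ} (hm : m ≤ r) (hp : p + r = p') (hn : n' + 1 = n)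
    {a : A.K.X n} (ha : a ∈ A.Zr m p n) : (H.h.hom n n').hom a ∈ B.Zr m p' n' := by
  subst hp
  refine (mem_Z hn).2 ⟨H.map_mem _ _ _ _ ha.1, ?_⟩
  rw [eq_sub_of_add_eq' (H.hom_d_add_d_hom' hn rfl a)]
  refine Submodule.sub_mem _ (B.F_mono _ (by lia)
    (Submodule.sub_mem _ (g.map_mem _ _ _ ha.1) (f.map_mem _ _ _ ha.1))) ?_
  exact B.F_mono _ (by lia) (H.map_mem _ _ n _ ha.2)

/-- For a boundary `y + d w`, the homotopy identity gives `h (y + d w) = (h y + (g - f) w) + d (-h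
w)`. The bound `m ≤ r` lowers the filtration `p + m - 1` of `w` to at most `p + r - 1`, as the first
summand requires. -/
lemma map_mem_B {m p p' n n' : ℤ} (hm : m ≤ r) (hp : p + r = p') (hn : n' + 1 = n)
    {a : A.K.X n} (ha : a ∈ A.Br m p n) : (H.h.hom n n').hom a ∈ B.Br m p' n' := by
  subst hn
  obtain ⟨y, hy, w, hw, rfl⟩ := (mem_B rfl).1 ha
  have key := H.hom_d_add_d_hom' (sub_add_cancel n' 1) rfl w
  refine (mem_B (sub_add_cancel n' 1)).2
    ⟨(H.h.hom _ n').hom y + ((g.f.f n').hom w - (f.f.f n').hom w), ?_,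
      -(H.h.hom n' (n' - 1)).hom w, ?_, ?_⟩
  · refine Submodule.add_mem _ (H.map_mem_Z (by lia) (by lia) rfl hy) ?_
    exact Z_mono (by lia) (by lia)
      (Submodule.sub_mem _ (FilteredComplex.map_mem_Z g hw) (FilteredComplex.map_mem_Z f hw))
  · exact Submodule.neg_mem _ (H.map_mem_Z (by lia) (by lia) (sub_add_cancel n' 1) hw)
  · rw [← key, map_neg, map_add]; abel

/-- Homotopic morphisms agree from the page `r + 1` on. -/
lemma pageMap_eq {m : ℤ} (hm : r < m) : pageMap f m = pageMap g m := by
  ext i x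
  obtain ⟨x, rfl⟩ := Submodule.mkQ_surjective _ x
  refine ((Submodule.Quotient.eq _).2 ?_).symm
  have hn := sub_add_cancel (i.2 - i.1) 1
  have key := H.hom_d_add_d_hom' hn rfl x.1
  have h1 := f.map_mem _ _ _ x.2.1
  have h2 := g.map_mem _ _ _ x.2.1
  have h3 : (H.h.hom (i.2 - i.1 + 1) (i.2 - i.1)).hom ((A.K.d _ _).hom x.1) ∈
      B.F (i.1 - m + r) (i.2 - i.1) := H.map_mem _ _ _ _ x.2.2
  -- The boundary decomposition of `(g - f) a` is `h d a + d (h a)`. As `r ≤ m - 1`, `h d a` lies in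
  -- `F_(p - 1)` and `h a` in `F_(p + m - 1)`. The conditions on their differentials follow by
  -- solving the same identity for the other term.
  refine (mem_B hn).2 ⟨_, ⟨B.F_mono _ (by lia) h3, ?_⟩, _, ?_, key⟩
  · change (B.K.d _ _).hom _ ∈ B.F _ _
    rw [eq_sub_of_add_eq key, map_sub, map_sub, d_d, sub_zero]
    exact B.F_mono _ (by lia) (Submodule.sub_mem _ (FilteredComplex.map_mem_Z g x.2).2
      (FilteredComplex.map_mem_Z f x.2).2)
  · refine (mem_Z hn).2 ⟨B.F_mono _ (by lia) (H.map_mem _ _ _ _ x.2.1), ?_⟩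
    rw [eq_sub_of_add_eq' key]
    exact Submodule.sub_mem _ (B.F_mono _ (by lia) (Submodule.sub_mem _ h2 h1))
      (B.F_mono _ (by lia) h3)

/-! ### The morphism to the path object on the pages up to `r`. -/

omit H in
lemma shift_deg (r : ℕ) (i : ℤ × ℤ) :
    ((SpSe.shift r i).2 - (SpSe.shift r i).1) + 1 = i.2 - i.1 := by
  change (i.2 + r - 1) - (i.1 + r) + 1 = _
  ring

/-- The map `[a]_m ↦ [h a]_m`, for `m ≤ r`. -/
noncomputable def midMap {m : ℤ} (hm : m ≤ r) (i : ℤ × ℤ) :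
    A.E m i →ₗ[R] B.E m (SpSe.shift r i) :=
  Submodule.mapQ _ _
    ((H.h.hom (i.2 - i.1) ((SpSe.shift r i).2 - (SpSe.shift r i).1)).hom.restrict
      (fun _ hx => H.map_mem_Z hm rfl (shift_deg r i) hx))
    (fun _ hx => H.map_mem_B hm rfl (shift_deg r i) hx)

-- On page `r` the connecting map is only a transport between equal bidegrees; on classes it becomes
-- the transport of representatives between equal degrees of the complex.
omit H in
lemma conn_mk {m : ℤ} {i j : ℤ × ℤ} (h : m = r ∧ i = SpSe.shift r j)
    (e : i.2 - i.1 = (SpSe.shift r j).2 - (SpSe.shift r j).1)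
    (x : B.Zr m i.1 (i.2 - i.1))
    (hx : (B.K.XIsoOfEq e).hom.hom x.1 ∈
      B.Zr m (SpSe.shift r j).1 ((SpSe.shift r j).2 - (SpSe.shift r j).1)) :
    SpSe.conn r (B.page m) i j (E.mk B m i x) =
      E.mk B m (SpSe.shift r j) ⟨(B.K.XIsoOfEq e).hom.hom x.1, hx⟩ := by
  rw [SpSe.conn, dif_pos h]
  obtain ⟨_, rfl⟩ := h
  simp
  rfl

/-- The compatibility of `[a]_m ↦ [h a]_m` with the differentials. -/
lemma midMap_d {m : ℤ} (hm : m ≤ r) {i j : ℤ × ℤ} (hij : (pageShape m).Rel i j)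
    (x : A.Zr m i.1 (i.2 - i.1)) :
    -SpSe.conn r (B.page m) i j (E.map f m i (E.mk A m i x)) -
        ((B.page m).d (SpSe.shift r i) (SpSe.shift r j)).hom (H.midMap hm i (E.mk A m i x)) +
        SpSe.conn r (B.page m) i j (E.map g m i (E.mk A m i x)) =
      H.midMap hm j (((A.page m).d i j).hom (E.mk A m i x)) := by
  have hs := SpSe.shift_rel r hij
  have e : i.2 - i.1 = (SpSe.shift r j).2 - (SpSe.shift r j).1 := by
    have := shape_snd hij
    have := shift_deg r j
    lia
  have key := H.hom_d_add_d_hom (shift_deg r i) (shape_snd hij) e x.1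
  have hf := FilteredComplex.map_mem_Z f x.2
  have hg := FilteredComplex.map_mem_Z g x.2
  have hd := page_d_mk B hs ⟨_, H.map_mem_Z hm rfl (shift_deg r i) x.2⟩
  have hl : ((B.page m).d (SpSe.shift r i) (SpSe.shift r j)).hom (H.midMap hm i (E.mk A m i x)) =
    _ := hd
  rw [page_d_mk A hij x]
  -- Plain congruence, stated in the quotients `E`, to which the objects of `page` unfold.
  have combine : ∀ {a b c d : B.E m (SpSe.shift r j)}, a = b → c = d →
      ∀ {y y' : B.E m (SpSe.shift r j)}, y = y' → -a - y + c = -b - y' + d := by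
    rintro _ _ _ _ rfl rfl _ _ rfl; rfl
  have hj : i.1 - m = j.1 := shape_fst hij
  have hp : (SpSe.shift r j).1 = j.1 + r := rfl
  -- For `m = r` the identity already holds between representatives; for `m < r` the connecting
  -- terms vanish and it holds only modulo boundaries.
  by_cases h : m = r
  · have hi : i = SpSe.shift r j := by
      have : i + (-m, 1 - m) = j := hij
      rw [← this]; ext <;> simp [h] <;> ring
    have h1 := conn_mk (B := B) ⟨h, hi⟩ e ⟨_, hf⟩ (XIsoOfEq_mem_Z (by lia) e hf)
    have h2 := conn_mk (B := B) ⟨h, hi⟩ e ⟨_, hg⟩ (XIsoOfEq_mem_Z (by lia) e hg)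
    refine (combine h1 h2 hl).trans ?_
    rw [← map_neg, ← map_sub, ← map_add]
    refine congrArg (E.mk B m (SpSe.shift r j)) (Subtype.ext ?_)
    change -(B.K.XIsoOfEq e).hom.hom ((f.f.f _).hom x.1) - (B.K.d _ _).hom ((H.h.hom _ _).hom x.1) +
      (B.K.XIsoOfEq e).hom.hom ((g.f.f _).hom x.1) = (H.h.hom _ _).hom ((A.K.d _ _).hom x.1)
    rw [eq_sub_of_add_eq key, map_sub]; abel
  · have h0 := SpSe.conn_of_ne r (B.page m) h i j
    refine (combine (LinearMap.congr_fun h0 _) (LinearMap.congr_fun h0 _) hl).trans ?_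
    change -(0 : B.E m (SpSe.shift r j)) - _ + (0 : B.E m (SpSe.shift r j)) = _
    rw [neg_zero, zero_sub, add_zero, ← map_neg]
    refine (Submodule.Quotient.eq _).2 ?_
    -- The discrepancy `-d h a - h d a` is `-(g - f) a`. It has filtration `p ≤ p + r - m - 1` since
    -- `m < r`, so it is in the `Z_(m - 1)` summand of the boundaries and no term `d w` is needed.
    refine (mem_B (sub_add_cancel _ 1)).2
      ⟨-(B.K.XIsoOfEq e).hom.hom ((g.f.f _).hom x.1 - (f.f.f _).hom x.1), ?_, 0,
        Submodule.zero_mem _, ?_⟩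
    · exact Submodule.neg_mem _ (XIsoOfEq_mem_Z rfl e
        (Z_mono (by lia) (by lia) (Submodule.sub_mem _ hg hf)))
    · rw [map_zero, add_zero, ← key]
      change -(_ + _) = -(B.K.d _ _).hom ((H.h.hom _ _).hom x.1) -
        (H.h.hom _ _).hom ((A.K.d _ _).hom x.1)
      abel

/-- The map `[a]_m ↦ ([f a]_m, [h a]_m, [g a]_m)`, for `m ≤ r`. -/
noncomputable def lowMap {m : ℤ} (hm : m ≤ r) : A.page m ⟶ SpSe.lowPage r (B.page m) where
  f i := ModuleCat.ofHom ((E.map f m i).prod ((H.midMap hm i).prod (E.map g m i)))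
  comm' i j hij := by
    ext x
    obtain ⟨x, rfl⟩ := Submodule.mkQ_surjective _ x
    refine (SpSe.lowPage_d r (B.page m) hij _).trans ?_
    have hf := congrArg (fun t => t.hom (E.mk A m i x)) ((pageMap f m).comm i j)
    have hg := congrArg (fun t => t.hom (E.mk A m i x)) ((pageMap g m).comm i j)
    exact Prod.ext hf (Prod.ext (H.midMap_d hm hij x) hg)

lemma lowMap_fst {m : ℤ} (hm : m ≤ r) :
    H.lowMap hm ≫ SpSe.lowFst r (B.page m) = pageMap f m := by
  ext i x; rfl

lemma lowMap_snd {m : ℤ} (hm : m ≤ r) :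
    H.lowMap hm ≫ SpSe.lowSnd r (B.page m) = pageMap g m := by
  ext i x; rfl

/-- Both composites can be tested on an `(m + 1)`-cycle `a`, whose images `f a`, `h a`, `g a` are
again `(m + 1)`-cycles. For `h a` this uses `m + 1 ≤ r`, so the argument stops just before page `r`.
-/
lemma lowMap_comm {m m' : ℤ} (h : m + 1 = m') (hm : m < r) (hm' : m' ≤ r) (i : ℤ × ℤ) :
    HomologicalComplex.homologyMap (H.lowMap hm.le) i ≫
        (SpSe.isoLt r (fun i => B.isoHomology m m' h i) hm.ne i).hom =
      (A.isoHomology m m' h i).hom ≫ (H.lowMap hm').f i := by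
  -- Starting from the next page makes a representative in `Z_(m + 1)` available, rather than a mere
  -- cycle of page `m`.
  rw [← Iso.inv_comp_eq]
  ext x
  obtain ⟨x, rfl⟩ := Submodule.mkQ_surjective _ x
  let z := A.toKer m m' h i x
  have hz : ((SpSe.lowPage r (B.page m)).d i (i + (-m, 1 - m))).hom
      (((H.lowMap hm.le).f i).hom z.1) = 0 := by
    rw [← LinearMap.comp_apply, ← ModuleCat.hom_comp, (H.lowMap hm.le).comm]
    exact (congrArg ((H.lowMap hm.le).f _).hom z.2).trans (map_zero _)
  have h1 := HomologyClass.map_mk (H.lowMap hm.le) (next_eq m i) z ⟨_, hz⟩ rfl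
  refine (congrArg (SpSe.isoLt r (fun i => B.isoHomology m m' h i) hm.ne i).hom.hom h1).trans ?_
  refine (HomologyClass.isoOfCycles_hom_mk _ _ _ _ _ _ _).trans ?_
  refine Prod.ext ?_ (Prod.ext ?_ ?_)
  · exact B.isoHomology_hom_mk m m' h (next_eq m i) ⟨_, FilteredComplex.map_mem_Z f x.2⟩ _ rfl
  · exact B.isoHomology_hom_mk m m' h (SpSe.next_shift r m i)
      ⟨_, H.map_mem_Z hm' rfl (shift_deg r i) x.2⟩ _ rfl
  · exact B.isoHomology_hom_mk m m' h (next_eq m i) ⟨_, FilteredComplex.map_mem_Z g x.2⟩ _ rfl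

/-! ### Assembling the pages into a homotopy of spectral sequences. -/

/-- The `m`-th page of the morphism to the path object. -/
noncomputable def pathMapPage (m : ℤ) (hm : 0 ≤ m) :
    A.page m ⟶ SpSe.pathPage r B.spectralSequence m hm :=
  if h : m ≤ r then H.lowMap h ≫ (SpSe.lowIso r B.spectralSequence hm h).inv
  else pageMap f m ≫ (SpSe.highIso r B.spectralSequence hm (not_le.1 h)).inv

/-- The morphism to the path object defined by a homotopy. -/
noncomputable def pathMap :
    A.spectralSequence ⟶ SpSe.path r B.spectralSequence where
  hom m hm := H.pathMapPage m hm
  comm m m' i h hm := by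
    have hfun := ((spectralSequenceFunctor.{v} R).map f).comm m m' i h hm
    change HomologicalComplex.homologyMap (pageMap f m) i ≫ (B.isoHomology m m' h i).hom =
      (A.isoHomology m m' h i).hom ≫ (pageMap f m').f i at hfun
    change HomologicalComplex.homologyMap (H.pathMapPage m hm) i ≫
        (SpSe.pathIso r B.spectralSequence m m' i h hm).hom =
      (A.isoHomology m m' h i).hom ≫ (H.pathMapPage m' (by lia)).f i
    unfold SpSe.pathIso pathMapPage
    rcases lt_trichotomy m (r : ℤ) with h₁ | h₁ | h₁
    · rw [dif_pos h₁, dif_pos h₁.le, dif_pos (by lia : m' ≤ r)]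
      exact homologyMap_comp_inv_comp _ _ _ _ _ _ (H.lowMap_comm h h₁ (by lia) i)
    · rw [dif_neg (by lia : ¬ m < r), dif_pos h₁, dif_pos h₁.le, dif_neg (by lia : ¬ m' ≤ r)]
      -- From page `r` to page `r + 1` only the first component survives, and it is `f`; the square
      -- is therefore that of the functor applied to `f`.
      have hr : HomologicalComplex.homologyMap (H.lowMap h₁.le) i ≫
          (SpSe.isoEq r (fun i => B.isoHomology m m' h i) h₁ i).hom =
            (A.isoHomology m m' h i).hom ≫ (pageMap f m').f i := by
        rw [SpSe.isoEq_hom_fst, ← HomologicalComplex.homologyMap_comp_assoc, lowMap_fst, hfun]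
      exact homologyMap_comp_inv_comp _ _ _ _ _ _ hr
    · rw [dif_neg (by lia : ¬ m < r), dif_neg (by lia : ¬ m = r), dif_neg (by lia : ¬ m ≤ r),
        dif_neg (by lia : ¬ m' ≤ r)]
      exact homologyMap_comp_inv_comp _ _ _ _ _ _ hfun

lemma pathMap_fst :
    H.pathMap ≫ SpSe.pathFst r B.spectralSequence = (spectralSequenceFunctor.{v} R).map f := by
  apply CategoryTheory.SpectralSequence.hom_ext
  intro m hm
  change H.pathMapPage m hm ≫ SpSe.pathFstPage r B.spectralSequence m hm = pageMap f m
  unfold pathMapPage SpSe.pathFstPage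
  split_ifs with h
  · exact (comp_inv_comp_hom_comp _ _ _).trans (H.lowMap_fst h)
  · exact comp_inv_comp_hom _ _

lemma pathMap_snd :
    H.pathMap ≫ SpSe.pathSnd r B.spectralSequence = (spectralSequenceFunctor.{v} R).map g := by
  apply CategoryTheory.SpectralSequence.hom_ext
  intro m hm
  change H.pathMapPage m hm ≫ SpSe.pathSndPage r B.spectralSequence m hm = pageMap g m
  unfold pathMapPage SpSe.pathSndPage
  split_ifs with h
  · exact (comp_inv_comp_hom_comp _ _ _).trans (H.lowMap_snd h)
  -- Beyond page `r` the morphism was built from `f`, so its agreement with `g` is where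
  -- `pageMap_eq` enters.
  · exact (comp_inv_comp_hom _ _).trans (H.pageMap_eq (not_le.1 h))

end RHomotopy

end FilteredComplex

/-- The spectral sequence functor from filtered complexes to spectral sequences sends
`r`-homotopic morphisms to `r`-homotopic morphisms. -/
theorem mainTheorem8 {R : Type u} [CommRing R] (r : ℕ) {A B : FilteredComplex.{v} R}
    (f g : A ⟶ B) (h : Nonempty (FilteredComplex.RHomotopy r f g)) :
    Nonempty (SpSe.RHomotopy r ((spectralSequenceFunctor.{v} R).map f)
      ((spectralSequenceFunctor.{v} R).map g)) := by
  obtain ⟨H⟩ := h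
  exact ⟨⟨H.pathMap, H.pathMap_fst, H.pathMap_snd⟩⟩
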